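/- For a finite set $A$ of integers and an integer $m \ge 1$ let $mA = A + \cdots + A$ ($m$ summands), let $0A = \{0\}$, and let $sA - dA = \{x - y : x \in sA,\ y \in dA\}$. Let $s_1, d_1, s_2, d_2$ be non-negative integers with $s_1 + d_1 = s_2 + d_2 = k \ge 2$ and $\{s_1, d_1\} \ne \{s_2, d_2\}$. Then a positive proportion of all finite sets satisfies $|s_1A - d_1A| > |s_2A - d_2A|$: there is a constant $c > 0$ (depending only on $s_1, d_1, s_2, d_2$) such that for all sufficiently large $n$ at least $c\,2^{n+1}$ of the $2^{n+1}$ subsets $A$ of $\{0, 1, \dots, n\}$ satisfy this inequality. Moreover, assume that $s_1$ is the largest of $s_1, d_1, s_2, d_2$. Let $i, j$ be non-negative integers with $j \le 2i$, where, in case $s_2 = d_2$, $j$ is even. Then for all sufficiently large $n$ there is a set $A \subseteq \{0, 1, \dots, n\}$ such that $|s_1A - d_1A| = kn + 1 - i$ and $|s_2A - d_2A| = kn + 1 - j$. -/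

import Mathlib

open scoped Pointwise

/-- `kFold k A` is the `k`-fold sumset `A + ⋯ + A` (`k` summands); `kFold 0 A = {0}`.
This is the iterated pointwise sum, not the dilate of `A` by `k`. -/
def kFold (k : ℕ) (A : Finset ℤ) : Finset ℤ :=
  Finset.nsmul.smul k A

theorem kFold_zero (A : Finset ℤ) : kFold 0 A = {0} :=
  zero_nsmul A

theorem kFold_succ (k : ℕ) (A : Finset ℤ) : kFold (k + 1) A = kFold k A + A :=
  succ_nsmul A k

/-- The generalized sum-difference set `sA - dA`. -/
def sumDiff (s d : ℕ) (A : Finset ℤ) : Finset ℤ :=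
  kFold s A - kFold d A

theorem mem_kFold_zero {A : Finset ℤ} {x : ℤ} : x ∈ kFold 0 A ↔ x = 0 := by
  rw [kFold_zero, Finset.mem_singleton]

theorem mem_kFold_succ {k : ℕ} {A : Finset ℤ} {x : ℤ} :
    x ∈ kFold (k + 1) A ↔ ∃ a ∈ kFold k A, ∃ b ∈ A, a + b = x := by
  rw [kFold_succ, Finset.mem_add]

theorem zero_mem_kFold {k : ℕ} {A : Finset ℤ} (h : 0 ∈ A) : 0 ∈ kFold k A := by
  induction k with
  | zero => simp [mem_kFold_zero]
  | succ k ih => exact mem_kFold_succ.2 ⟨0, ih, 0, h, by simp⟩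

theorem mul_mem_kFold {k : ℕ} {A : Finset ℤ} {m : ℤ} (h : m ∈ A) : (k : ℤ) * m ∈ kFold k A := by
  induction k with
  | zero => simp [mem_kFold_zero]
  | succ k ih => exact mem_kFold_succ.2 ⟨_, ih, m, h, by push_cast; ring⟩

theorem nonneg_of_mem_kFold {k : ℕ} {A : Finset ℤ} (h : ∀ x ∈ A, 0 ≤ x) :
    ∀ {x : ℤ}, x ∈ kFold k A → 0 ≤ x := by
  induction k with
  | zero => intro x hx; rw [mem_kFold_zero] at hx; omega
  | succ k ih =>
    intro x hx
    obtain ⟨a, ha, b, hb, rfl⟩ := mem_kFold_succ.1 hx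
    have := ih ha
    have := h b hb
    omega

theorem le_of_mem_kFold {k : ℕ} {A : Finset ℤ} {c : ℤ} (h : ∀ x ∈ A, x ≤ c) :
    ∀ {x : ℤ}, x ∈ kFold k A → x ≤ k * c := by
  induction k with
  | zero => intro x hx; rw [mem_kFold_zero] at hx; simp [hx]
  | succ k ih =>
    intro x hx
    obtain ⟨a, ha, b, hb, rfl⟩ := mem_kFold_succ.1 hx
    have := ih ha
    have := h b hb
    push_cast
    linarith

theorem kFold_truncate {k : ℕ} {A B : Finset ℤ} {N : ℤ} (h : ∀ x ∈ A, 0 ≤ x)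
    (hAB : ∀ x ∈ A, x ≤ N → x ∈ B) : ∀ {x : ℤ}, x ∈ kFold k A → x ≤ N → x ∈ kFold k B := by
  induction k with
  | zero => intro x hx _; rw [mem_kFold_zero] at hx ⊢; exact hx
  | succ k ih =>
    intro x hx hxN
    obtain ⟨a, ha, b, hb, rfl⟩ := mem_kFold_succ.1 hx
    have h0 := nonneg_of_mem_kFold h ha
    have h1 := h b hb
    exact mem_kFold_succ.2 ⟨a, ih ha (by omega), b, hAB b hb (by omega), rfl⟩

/-- The reflection `c - A`. -/
def reflect (c : ℤ) (A : Finset ℤ) : Finset ℤ :=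
  A.image (fun x => c - x)

theorem mem_reflect {c : ℤ} {A : Finset ℤ} {x : ℤ} : x ∈ reflect c A ↔ c - x ∈ A := by
  unfold reflect
  rw [Finset.mem_image]
  constructor
  · rintro ⟨y, hy, rfl⟩; simpa using hy
  · intro h; exact ⟨_, h, by ring⟩

theorem mem_kFold_reflect {k : ℕ} {c : ℤ} {A : Finset ℤ} :
    ∀ {x : ℤ}, x ∈ kFold k (reflect c A) ↔ k * c - x ∈ kFold k A := by
  induction k with
  | zero => intro x; simp [mem_kFold_zero]
  | succ k ih =>
    intro x
    rw [mem_kFold_succ, mem_kFold_succ]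
    constructor
    · rintro ⟨a, ha, b, hb, rfl⟩
      exact ⟨_, ih.1 ha, _, mem_reflect.1 hb, by push_cast; ring⟩
    · rintro ⟨a, ha, b, hb, hab⟩
      refine ⟨k * c - a, ih.2 (by simpa using ha), c - b, mem_reflect.2 (by simpa using hb), ?_⟩
      push_cast at hab
      linarith

/-- The mixed sumset `sA + dB`. -/
def mixedSum (s d : ℕ) (A B : Finset ℤ) : Finset ℤ :=
  kFold s A + kFold d B

theorem mem_mixedSum {s d : ℕ} {A B : Finset ℤ} {x : ℤ} :
    x ∈ mixedSum s d A B ↔ ∃ a ∈ kFold s A, ∃ b ∈ kFold d B, a + b = x :=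
  Finset.mem_add

theorem mixedSum_comm (s d : ℕ) (A B : Finset ℤ) : mixedSum s d A B = mixedSum d s B A :=
  add_comm _ _

theorem mem_mixedSum_reflect {s d : ℕ} {a b : ℤ} {A B : Finset ℤ} {x : ℤ} :
    x ∈ mixedSum s d (reflect a A) (reflect b B) ↔ s * a + d * b - x ∈ mixedSum s d A B := by
  rw [mem_mixedSum, mem_mixedSum]
  constructor
  · rintro ⟨u, hu, v, hv, rfl⟩
    exact ⟨_, mem_kFold_reflect.1 hu, _, mem_kFold_reflect.1 hv, by ring⟩
  · rintro ⟨u, hu, v, hv, h⟩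
    refine ⟨s * a - u, mem_kFold_reflect.2 (by simpa using hu), d * b - v,
      mem_kFold_reflect.2 (by simpa using hv), by linarith⟩

theorem card_sumDiff_comm (s d : ℕ) (A : Finset ℤ) :
    (sumDiff s d A).card = (sumDiff d s A).card := by
  have : sumDiff d s A = -(sumDiff s d A) := by
    unfold sumDiff; rw [neg_sub]
  rw [this, Finset.card_neg]

theorem card_sumDiff_eq_card_mixedSum (s d : ℕ) (n : ℤ) (A : Finset ℤ) :
    (sumDiff s d A).card = (mixedSum s d A (reflect n A)).card := by
  have : mixedSum s d A (reflect n A) = (sumDiff s d A).image (fun x => x + d * n) := by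
    ext x
    rw [mem_mixedSum, Finset.mem_image]
    constructor
    · rintro ⟨u, hu, v, hv, rfl⟩
      exact ⟨_, Finset.sub_mem_sub hu (mem_kFold_reflect.1 hv), by ring⟩
    · rintro ⟨y, hy, rfl⟩
      obtain ⟨u, hu, v, hv, rfl⟩ := Finset.mem_sub.1 hy
      exact ⟨u, hu, d * n - v, mem_kFold_reflect.2 (by simpa using hv), by ring⟩
  rw [this, Finset.card_image_of_injective _ (add_left_injective _)]

theorem mixedSum_truncate {s d : ℕ} {A B L R : Finset ℤ} {N : ℤ} (hA : ∀ x ∈ A, 0 ≤ x)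
    (hB : ∀ x ∈ B, 0 ≤ x) (hAL : ∀ x ∈ A, x ≤ N → x ∈ L) (hBR : ∀ x ∈ B, x ≤ N → x ∈ R)
    {x : ℤ} (hx : x ∈ mixedSum s d A B) (hxN : x ≤ N) : x ∈ mixedSum s d L R := by
  obtain ⟨u, hu, v, hv, rfl⟩ := mem_mixedSum.1 hx
  have h0 := nonneg_of_mem_kFold hA hu
  have h1 := nonneg_of_mem_kFold hB hv
  exact mem_mixedSum.2 ⟨u, kFold_truncate hA hAL hu (by omega), v,
    kFold_truncate hB hBR hv (by omega), rfl⟩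

/-- The elements of `[0, N]` that are missing from `sL + dR`. -/
noncomputable def missing (N : ℤ) (s d : ℕ) (L R : Finset ℤ) : Finset ℤ :=
  Finset.Icc 0 N \ mixedSum s d L R

theorem mem_missing {N : ℤ} {s d : ℕ} {L R : Finset ℤ} {x : ℤ} :
    x ∈ missing N s d L R ↔ (0 ≤ x ∧ x ≤ N) ∧ x ∉ mixedSum s d L R := by
  rw [missing, Finset.mem_sdiff, Finset.mem_Icc]

/-- `A ⊆ [0, n]` agrees with `L` near `0` and with `n - R` near `n`. -/
structure HasFringe (n N : ℤ) (L R A : Finset ℤ) : Prop where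
  subset : A ⊆ Finset.Icc 0 n
  left : ∀ x ≤ N, x ∈ A ↔ x ∈ L
  right : ∀ x ≤ N, n - x ∈ A ↔ x ∈ R

theorem HasFringe.reflect {n N : ℤ} {L R A : Finset ℤ} (h : HasFringe n N L R A) :
    HasFringe n N R L (reflect n A) where
  subset x hx := by
    have := Finset.mem_Icc.1 (h.subset (mem_reflect.1 hx))
    rw [Finset.mem_Icc]; omega
  left x hx := by rw [mem_reflect]; exact h.right x hx
  right x hx := by rw [mem_reflect]; simpa using h.left x hx

theorem HasFringe.nonneg {n N : ℤ} {L R A : Finset ℤ} (h : HasFringe n N L R A) :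
    ∀ x ∈ A, 0 ≤ x := fun _ hx => (Finset.mem_Icc.1 (h.subset hx)).1

theorem HasFringe.mem_mixedSum_iff {n N : ℤ} {L R A : Finset ℤ} (h : HasFringe n N L R A)
    (hL : L ⊆ Finset.Icc 0 N) (hR : R ⊆ Finset.Icc 0 N) {s d : ℕ} {x : ℤ} (hx : x ≤ N) :
    x ∈ mixedSum s d A (_root_.reflect n A) ↔ x ∈ mixedSum s d L R := by
  have hL' : ∀ y ∈ L, 0 ≤ y ∧ y ≤ N := fun y hy => Finset.mem_Icc.1 (hL hy)
  have hR' : ∀ y ∈ R, 0 ≤ y ∧ y ≤ N := fun y hy => Finset.mem_Icc.1 (hR hy)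
  constructor
  · intro hm
    exact mixedSum_truncate h.nonneg h.reflect.nonneg (fun y hy hyN => (h.left y hyN).1 hy)
      (fun y hy hyN => (h.reflect.left y hyN).1 hy) hm hx
  · intro hm
    exact mixedSum_truncate (fun y hy => (hL' y hy).1) (fun y hy => (hR' y hy).1)
      (fun y hy hyN => (h.left y hyN).2 hy) (fun y hy hyN => (h.reflect.left y hyN).2 hy) hm hx

theorem HasFringe.mixedSum_subset {n N : ℤ} {L R A : Finset ℤ} (h : HasFringe n N L R A)
    (hL : L ⊆ Finset.Icc 0 N) (hR : R ⊆ Finset.Icc 0 N) (s d : ℕ) :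
    mixedSum s d A (_root_.reflect n A) ⊆ Finset.Icc 0 ((s + d) * n) \
      (missing N s d L R ∪ _root_.reflect ((s + d) * n) (missing N d s L R)) := by
  intro x hx
  rw [Finset.mem_sdiff, Finset.mem_union, not_or, mem_reflect, mem_missing, mem_missing]
  refine ⟨?_, ?_, ?_⟩
  · obtain ⟨u, hu, v, hv, rfl⟩ := mem_mixedSum.1 hx
    have h0 := nonneg_of_mem_kFold h.nonneg hu
    have h1 := nonneg_of_mem_kFold h.reflect.nonneg hv
    have h2 := le_of_mem_kFold (fun y hy => (Finset.mem_Icc.1 (h.subset hy)).2) hu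
    have h3 := le_of_mem_kFold (fun y hy => (Finset.mem_Icc.1 (h.reflect.subset hy)).2) hv
    rw [Finset.mem_Icc]
    constructor
    · omega
    · linarith
  · rintro ⟨⟨_, h1⟩, h2⟩
    exact h2 ((h.mem_mixedSum_iff hL hR h1).1 hx)
  · rintro ⟨⟨_, h1⟩, h2⟩
    apply h2
    rw [mixedSum_comm, ← h.reflect.mem_mixedSum_iff hR hL h1, mem_mixedSum_reflect]
    convert hx using 1
    ring

theorem HasFringe.mixedSum_eq {n N : ℤ} {L R A : Finset ℤ} (h : HasFringe n N L R A)
    (hL : L ⊆ Finset.Icc 0 N) (hR : R ⊆ Finset.Icc 0 N) {s d : ℕ}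
    (hmid : Finset.Icc (N + 1) ((s + d) * n - N - 1) ⊆ mixedSum s d A (_root_.reflect n A)) :
    mixedSum s d A (_root_.reflect n A) = Finset.Icc 0 ((s + d) * n) \
      (missing N s d L R ∪ _root_.reflect ((s + d) * n) (missing N d s L R)) := by
  refine (h.mixedSum_subset hL hR s d).antisymm ?_
  intro x hx
  rw [Finset.mem_sdiff, Finset.mem_union, not_or, mem_reflect, mem_missing, mem_missing,
    Finset.mem_Icc] at hx
  obtain ⟨⟨h0, h1⟩, h2, h3⟩ := hx
  by_cases hxN : x ≤ N
  · rw [h.mem_mixedSum_iff hL hR hxN]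
    by_contra hc
    exact h2 ⟨⟨h0, hxN⟩, hc⟩
  by_cases hxN' : (s + d) * n - x ≤ N
  · have h4 : (s + d) * n - x ∈ mixedSum d s L R := by
      by_contra hc
      exact h3 ⟨⟨by linarith, hxN'⟩, hc⟩
    rw [mixedSum_comm, ← h.reflect.mem_mixedSum_iff hR hL hxN', mem_mixedSum_reflect] at h4
    convert h4 using 1
    ring
  · apply hmid
    rw [Finset.mem_Icc]
    constructor
    · omega
    · linarith

theorem card_Icc_sdiff_missing {M N : ℤ} (s d : ℕ) (L R : Finset ℤ) (hN : 0 ≤ N)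
    (hM : 2 * N < M) :
    ((Finset.Icc 0 M \ (missing N s d L R ∪ reflect M (missing N d s L R))).card : ℤ) =
      M + 1 - ((missing N s d L R).card + (missing N d s L R).card) := by
  have hsub : missing N s d L R ∪ reflect M (missing N d s L R) ⊆ Finset.Icc 0 M := by
    intro x hx
    rw [Finset.mem_union, mem_reflect, mem_missing, mem_missing] at hx
    rw [Finset.mem_Icc]
    omega
  have hdisj : Disjoint (missing N s d L R) (reflect M (missing N d s L R)) := by
    rw [Finset.disjoint_left]
    intro x hx hx'
    rw [mem_reflect, mem_missing] at hx'
    rw [mem_missing] at hx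
    omega
  have hc : (reflect M (missing N d s L R)).card = (missing N d s L R).card :=
    Finset.card_image_of_injective _ sub_right_injective
  have := Finset.card_sdiff_add_card_eq_card hsub
  rw [Finset.card_union_of_disjoint hdisj, hc, Int.card_Icc] at this
  omega

theorem HasFringe.card_sumDiff_le {n N : ℤ} {L R A : Finset ℤ} (h : HasFringe n N L R A)
    (hL : L ⊆ Finset.Icc 0 N) (hR : R ⊆ Finset.Icc 0 N) (hN : 0 ≤ N) {s d : ℕ}
    (hn : 2 * N < (s + d) * n) :
    ((sumDiff s d A).card : ℤ) ≤
      (s + d) * n + 1 - ((missing N s d L R).card + (missing N d s L R).card) := by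
  rw [card_sumDiff_eq_card_mixedSum s d n, ← card_Icc_sdiff_missing s d L R hN hn]
  exact_mod_cast Finset.card_le_card (h.mixedSum_subset hL hR s d)

theorem HasFringe.card_sumDiff_eq {n N : ℤ} {L R A : Finset ℤ} (h : HasFringe n N L R A)
    (hL : L ⊆ Finset.Icc 0 N) (hR : R ⊆ Finset.Icc 0 N) (hN : 0 ≤ N) {s d : ℕ}
    (hn : 2 * N < (s + d) * n)
    (hmid : Finset.Icc (N + 1) ((s + d) * n - N - 1) ⊆ mixedSum s d A (_root_.reflect n A)) :
    ((sumDiff s d A).card : ℤ) =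
      (s + d) * n + 1 - ((missing N s d L R).card + (missing N d s L R).card) := by
  rw [card_sumDiff_eq_card_mixedSum s d n, ← card_Icc_sdiff_missing s d L R hN hn,
    h.mixedSum_eq hL hR hmid]

theorem mul_mem_mixedSum {s d t : ℕ} {A B : Finset ℤ} {n : ℤ} (hA0 : 0 ∈ A) (hAn : n ∈ A)
    (hB0 : 0 ∈ B) (hBn : n ∈ B) (ht : t ≤ s + d) : (t : ℤ) * n ∈ mixedSum s d A B := by
  have key : ∀ {C : Finset ℤ}, 0 ∈ C → n ∈ C → ∀ {m u : ℕ}, u ≤ m → (u : ℤ) * n ∈ kFold m C := by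
    intro C h0 hn m
    induction m with
    | zero =>
      intro u hu
      obtain rfl : u = 0 := by omega
      simp [mem_kFold_zero]
    | succ m ih =>
      intro u hu
      rcases Nat.eq_zero_or_pos u with rfl | hpos
      · simpa using zero_mem_kFold h0
      · obtain ⟨v, rfl⟩ : ∃ v, u = v + 1 := ⟨u - 1, by omega⟩
        exact mem_kFold_succ.2 ⟨_, ih (u := v) (by omega), n, hn, by push_cast; ring⟩
  refine mem_mixedSum.2 ⟨_, key hA0 hAn (u := min t s) (by omega), _,
    key hB0 hBn (u := t - min t s) (by omega), ?_⟩
  rw [← add_mul]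
  congr 1
  have : min t s ≤ t := min_le_left _ _
  push_cast [Nat.cast_sub this]
  ring

/-- If two suitable summands already cover the middle part of `[0, 2n]`, then
`sA + d(n - A)` covers the middle part of `[0, (s + d)n]`. -/
theorem Icc_subset_mixedSum {s d : ℕ} {A : Finset ℤ} {n N : ℤ} (hds : d ≤ s) (hk : 2 ≤ s + d)
    (hA0 : 0 ∈ A) (hAn : n ∈ A) (hN : 0 ≤ N) (hn : 2 * N + 1 ≤ n)
    (hcov : Finset.Icc (N + 1) (2 * n - N - 1) ⊆ A + (if 2 ≤ s then A else reflect n A)) :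
    Finset.Icc (N + 1) ((s + d) * n - N - 1) ⊆ mixedSum s d A (reflect n A) := by
  have hB0 : (0 : ℤ) ∈ reflect n A := mem_reflect.2 (by simpa using hAn)
  have hBn : n ∈ reflect n A := mem_reflect.2 (by simpa using hA0)
  intro z hz
  rw [Finset.mem_Icc] at hz
  obtain ⟨t, ht, h1, h2⟩ : ∃ t : ℕ, t + 2 ≤ s + d ∧ N + 1 ≤ z - t * n ∧
      z - t * n ≤ 2 * n - N - 1 := by
    have hn0 : 0 < n := by omega
    have e1 := Int.emod_add_mul_ediv (z - N - 1) n
    have e2 := Int.emod_nonneg (z - N - 1) hn0.ne'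
    have e3 := Int.emod_lt_of_pos (z - N - 1) hn0
    have e4 : 0 ≤ (z - N - 1) / n := Int.ediv_nonneg (by omega) hn0.le
    obtain ⟨f, hf⟩ : ∃ f : ℕ, (z - N - 1) / n = f := ⟨_, (Int.toNat_of_nonneg e4).symm⟩
    rw [hf] at e1
    by_cases hfk : f + 2 ≤ s + d
    · exact ⟨f, hfk, by linarith, by linarith⟩
    · refine ⟨s + d - 2, by omega, ?_, ?_⟩
      · have : ((s + d - 2 : ℕ) : ℤ) * n ≤ f * n :=
          mul_le_mul_of_nonneg_right (by omega) hn0.le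
        linarith
      · push_cast [Nat.cast_sub hk]
        linarith
  obtain ⟨x, hx, y, hy, hxy⟩ := Finset.mem_add.1 (hcov (Finset.mem_Icc.2 ⟨h1, h2⟩))
  split_ifs at hy with hs
  · obtain ⟨s', rfl⟩ : ∃ s', s = s' + 2 := ⟨s - 2, by omega⟩
    obtain ⟨u, hu, v, hv, huv⟩ := mem_mixedSum.1
      (mul_mem_mixedSum (s := s') (d := d) (t := t) hA0 hAn hB0 hBn (by omega))
    exact mem_mixedSum.2 ⟨u + x + y, mem_kFold_succ.2
      ⟨_, mem_kFold_succ.2 ⟨u, hu, x, hx, rfl⟩, y, hy, rfl⟩, v, hv, by linarith⟩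
  · obtain ⟨s', rfl⟩ : ∃ s', s = s' + 1 := ⟨s - 1, by omega⟩
    obtain ⟨d', rfl⟩ : ∃ d', d = d' + 1 := ⟨d - 1, by omega⟩
    obtain ⟨u, hu, v, hv, huv⟩ := mem_mixedSum.1
      (mul_mem_mixedSum (s := s') (d := d') (t := t) hA0 hAn hB0 hBn (by omega))
    exact mem_mixedSum.2 ⟨_, mem_kFold_succ.2 ⟨u, hu, x, hx, rfl⟩, _,
      mem_kFold_succ.2 ⟨v, hv, y, hy, rfl⟩, by linarith⟩

/-- Membership in `sA + dA` for sets `A` of residues `0` and `1` modulo `q`: either `x` is large, or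
its residue is at most `j` and `x` is not one of the excluded multiples of `q`. -/
def IsReachable (q h : ℤ) (C : Finset ℤ) (j : ℕ) (x : ℤ) : Prop :=
  0 ≤ x ∧ (2 * h ≤ x ∨ (x % q ≤ j ∧ (x % q = 0 → x = 0 ∨ (h ≤ x ∧ x ∉ C))))

theorem IsReachable.add {q h : ℤ} {C : Finset ℤ} {j l : ℕ} {x y : ℤ}
    (hx : IsReachable q h C j x) (hy : IsReachable q h C l y) (hq : (j + l : ℤ) < q) :
    IsReachable q h C (j + l) (x + y) := by
  obtain ⟨hx0, hx⟩ := hx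
  obtain ⟨hy0, hy⟩ := hy
  refine ⟨by omega, ?_⟩
  rcases hx with hx | ⟨hxj, hx⟩
  · left; omega
  rcases hy with hy | ⟨hyl, hy⟩
  · left; omega
  have ex : 0 ≤ x % q := Int.emod_nonneg _ (by omega)
  have ey : 0 ≤ y % q := Int.emod_nonneg _ (by omega)
  have e : (x + y) % q = x % q + y % q := by
    rw [Int.add_emod, Int.emod_eq_of_lt (by omega) (by omega)]
  rw [e]
  by_cases hz : x % q + y % q = 0
  · rcases hx (by omega) with rfl | ⟨hx1, hx2⟩
    · right
      refine ⟨by push_cast; omega, fun _ => ?_⟩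
      simpa using hy (by omega)
    · rcases hy (by omega) with rfl | ⟨hy1, hy2⟩
      · right
        refine ⟨by push_cast; omega, fun _ => ?_⟩
        right
        simpa using ⟨hx1, hx2⟩
      · left; omega
  · right
    exact ⟨by push_cast; omega, fun h => absurd h hz⟩

/-- The elements of `[0, a]` that are `1` modulo `q`, or large, or admissible multiples of `q`. -/
noncomputable def residueBlock (q h : ℤ) (C : Finset ℤ) (a : ℤ) : Finset ℤ :=
  (Finset.Icc 0 a).filter
    (fun x => 2 * h ≤ x ∨ x % q = 1 ∨ (x % q = 0 ∧ (x = 0 ∨ (h ≤ x ∧ x ∉ C))))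

theorem mem_residueBlock {q h : ℤ} {C : Finset ℤ} {a x : ℤ} :
    x ∈ residueBlock q h C a ↔ (0 ≤ x ∧ x ≤ a) ∧
      (2 * h ≤ x ∨ x % q = 1 ∨ (x % q = 0 ∧ (x = 0 ∨ (h ≤ x ∧ x ∉ C)))) := by
  rw [residueBlock, Finset.mem_filter, Finset.mem_Icc]

theorem isReachable_of_mem_residueBlock {q h : ℤ} {C : Finset ℤ} {a x : ℤ}
    (hx : x ∈ residueBlock q h C a) : IsReachable q h C 1 x := by
  obtain ⟨⟨h0, -⟩, h1 | h1 | ⟨h1, h2⟩⟩ := mem_residueBlock.1 hx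
  · exact ⟨h0, Or.inl h1⟩
  · exact ⟨h0, Or.inr ⟨by simp [h1], fun h => by omega⟩⟩
  · exact ⟨h0, Or.inr ⟨by simp [h1], fun _ => h2⟩⟩

theorem isReachable_of_mem_kFold {q h : ℤ} {C : Finset ℤ} {a : ℤ} {j : ℕ} (hj : (j : ℤ) < q) :
    ∀ {x : ℤ}, x ∈ kFold j (residueBlock q h C a) → IsReachable q h C j x := by
  induction j with
  | zero =>
    intro x hx
    rw [mem_kFold_zero] at hx
    subst hx
    exact ⟨le_rfl, Or.inr ⟨by simp, fun _ => Or.inl rfl⟩⟩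
  | succ j ih =>
    intro x hx
    push_cast at hj
    obtain ⟨u, hu, v, hv, rfl⟩ := mem_kFold_succ.1 hx
    exact (ih (by omega) hu).add (isReachable_of_mem_residueBlock hv) (by push_cast; omega)

theorem isReachable_of_mem_mixedSum {q h : ℤ} {C : Finset ℤ} {a b : ℤ} {s d : ℕ}
    (hq : (s + d : ℤ) < q) {x : ℤ}
    (hx : x ∈ mixedSum s d (residueBlock q h C a) (residueBlock q h C b)) :
    IsReachable q h C (s + d) x := by
  obtain ⟨u, hu, v, hv, rfl⟩ := mem_mixedSum.1 hx
  exact (isReachable_of_mem_kFold (by omega) hu).add (isReachable_of_mem_kFold (by omega) hv) hq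

theorem zero_mem_residueBlock {q h : ℤ} {C : Finset ℤ} {a : ℤ} (ha : 0 ≤ a) :
    (0 : ℤ) ∈ residueBlock q h C a :=
  mem_residueBlock.2 ⟨⟨le_rfl, ha⟩, Or.inr (Or.inr ⟨by simp, Or.inl rfl⟩)⟩

theorem mem_kFold_of_mem {k : ℕ} {A : Finset ℤ} {x : ℤ} (h0 : 0 ∈ A) (hx : x ∈ A) (hk : 1 ≤ k) :
    x ∈ kFold k A := by
  obtain ⟨l, rfl⟩ : ∃ l, k = l + 1 := ⟨k - 1, by omega⟩
  exact mem_kFold_succ.2 ⟨0, zero_mem_kFold h0, x, hx, by simp⟩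

theorem mem_kFold_residueBlock_of_large {q h : ℤ} {C : Finset ℤ} {a : ℤ} (hh : 0 ≤ h)
    (ha : 4 * h ≤ a) {k : ℕ} :
    ∀ {x : ℤ}, 2 * h ≤ x → x ≤ k * a → x ∈ kFold k (residueBlock q h C a) := by
  have h0 := zero_mem_residueBlock (q := q) (h := h) (C := C) (a := a) (by omega)
  induction k with
  | zero =>
    intro x hx hxk
    rw [mem_kFold_zero]
    simp at hxk
    omega
  | succ k ih =>
    intro x hx hxk
    push_cast at hxk
    by_cases hxa : x ≤ a
    · exact mem_kFold_of_mem h0 (mem_residueBlock.2 ⟨⟨by omega, hxa⟩, Or.inl hx⟩) (by omega)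
    by_cases hxa' : 2 * h ≤ x - a
    · exact mem_kFold_succ.2 ⟨x - a, ih hxa' (by linarith), a,
        mem_residueBlock.2 ⟨⟨by omega, le_rfl⟩, Or.inl (by omega)⟩, by ring⟩
    · have hk : k ≠ 0 := by
        rintro rfl
        simp at hxk
        omega
      have hka : a ≤ k * a := le_mul_of_one_le_left (by omega) (by omega)
      exact mem_kFold_succ.2 ⟨2 * h, ih le_rfl (by omega), x - 2 * h,
        mem_residueBlock.2 ⟨⟨by omega, by omega⟩, Or.inl (by omega)⟩, by ring⟩

theorem mem_mixedSum_residueBlock_of_large {q h : ℤ} {C : Finset ℤ} {a b : ℤ} (hh : 0 ≤ h)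
    (ha : 4 * h ≤ a) (hb : 4 * h ≤ b) {s d : ℕ} {x : ℤ} (hx : 2 * h ≤ x)
    (hxk : x ≤ s * a + d * b) :
    x ∈ mixedSum s d (residueBlock q h C a) (residueBlock q h C b) := by
  have ha0 := zero_mem_residueBlock (q := q) (h := h) (C := C) (a := a) (by omega)
  have hb0 := zero_mem_residueBlock (q := q) (h := h) (C := C) (a := b) (by omega)
  by_cases h1 : x ≤ s * a
  · exact mem_mixedSum.2 ⟨x, mem_kFold_residueBlock_of_large hh ha hx h1, 0,
      zero_mem_kFold hb0, by simp⟩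
  by_cases h2 : 2 * h ≤ x - s * a
  · refine mem_mixedSum.2 ⟨s * a, ?_, x - s * a,
      mem_kFold_residueBlock_of_large hh hb h2 (by linarith), by ring⟩
    exact mul_mem_kFold (mem_residueBlock.2 ⟨⟨by omega, le_rfl⟩, Or.inl (by omega)⟩)
  by_cases hs : s = 0
  · subst hs
    simp only [Nat.cast_zero, zero_mul, not_le, sub_zero] at h1 h2
    omega
  by_cases hd : d = 0
  · subst hd
    simp at hxk
    omega
  have hsa : a ≤ s * a := le_mul_of_one_le_left (by omega) (by omega)
  have hdb : b ≤ d * b := le_mul_of_one_le_left (by omega) (by omega)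
  exact mem_mixedSum.2 ⟨x - 2 * h, mem_kFold_residueBlock_of_large hh ha (by omega) (by omega),
    2 * h, mem_kFold_residueBlock_of_large hh hb le_rfl (by omega), by ring⟩

theorem mem_kFold_residueBlock_of_residue {q h : ℤ} {C : Finset ℤ} {a : ℤ} (hq : 1 < q) {k : ℕ} :
    ∀ {x : ℤ}, 0 ≤ x → x ≤ a → 1 ≤ x % q → x % q ≤ k → x ∈ kFold k (residueBlock q h C a) := by
  induction k with
  | zero =>
    intro x _ _ h1 h2
    simp at h2
    omega
  | succ k ih =>
    intro x hx hxa h1 h2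
    push_cast at h2
    by_cases h3 : x % q = 1
    · exact mem_kFold_of_mem (zero_mem_residueBlock (by omega))
        (mem_residueBlock.2 ⟨⟨hx, hxa⟩, Or.inr (Or.inl h3)⟩) (by omega)
    · have hlt := Int.emod_lt_of_pos x (show 0 < q by omega)
      have hx1 : x ≠ 0 := by
        rintro rfl
        simp at h1
      have h4 : (x - 1) % q = x % q - 1 := by
        rw [Int.sub_emod, Int.emod_eq_of_lt (a := 1) (by omega) hq,
          Int.emod_eq_of_lt (by omega) (by omega)]
      refine mem_kFold_succ.2 ⟨x - 1, ih (by omega) (by omega) (by omega) (by omega), 1,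
        mem_residueBlock.2 ⟨⟨by omega, by omega⟩, Or.inr (Or.inl ?_)⟩, by ring⟩
      exact Int.emod_eq_of_lt (by omega) hq

theorem mem_mixedSum_residueBlock_of_residue {q h : ℤ} {C : Finset ℤ} {a b : ℤ} (hq : 1 < q)
    {s d : ℕ} {x : ℤ} (hx : 0 ≤ x) (hxa : x ≤ a) (hxb : x ≤ b) (h1 : 1 ≤ x % q)
    (h2 : x % q ≤ s + d) :
    x ∈ mixedSum s d (residueBlock q h C a) (residueBlock q h C b) := by
  have hb0 := zero_mem_residueBlock (q := q) (h := h) (C := C) (a := b) (by omega)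
  by_cases h3 : x % q ≤ s
  · exact mem_mixedSum.2 ⟨x, mem_kFold_residueBlock_of_residue hq hx hxa h1 h3, 0,
      zero_mem_kFold hb0, by simp⟩
  · have hlt := Int.emod_lt_of_pos x (show 0 < q by omega)
    have hxq : x % q ≤ x := by
      have e1 := Int.emod_add_mul_ediv x q
      have e2 := mul_nonneg (show 0 ≤ q by omega) (Int.ediv_nonneg hx (show 0 ≤ q by omega))
      omega
    have h4 : (x - s) % q = x % q - s := by
      rw [Int.sub_emod, Int.emod_eq_of_lt (a := (s : ℤ)) (by omega) (by omega),
        Int.emod_eq_of_lt (by omega) (by omega)]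
    refine mem_mixedSum.2 ⟨s * 1, mul_mem_kFold (mem_residueBlock.2
      ⟨⟨by omega, by omega⟩, Or.inr (Or.inl (Int.emod_eq_of_lt (by omega) hq))⟩), x - s,
      mem_kFold_residueBlock_of_residue hq (by omega) (by omega) (by omega) (by omega), by ring⟩

/-- In the range `[0, sa + db]` the mixed sumset of two residue blocks misses exactly the excluded
multiples of `q`. -/
theorem mem_mixedSum_residueBlock_iff {q h : ℤ} {C : Finset ℤ} {a b : ℤ} {s d : ℕ}
    (hk : 1 ≤ s + d) (hq : q = s + d + 1) (hh : 0 ≤ h) (ha : 4 * h ≤ a) (hb : 4 * h ≤ b) {x : ℤ}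
    (hx : 0 ≤ x) (hxk : x ≤ s * a + d * b) :
    x ∈ mixedSum s d (residueBlock q h C a) (residueBlock q h C b) ↔
      ¬ (x < 2 * h ∧ x % q = 0 ∧ x ≠ 0 ∧ (x < h ∨ x ∈ C)) := by
  have hlt := Int.emod_lt_of_pos x (show 0 < q by omega)
  have hnn := Int.emod_nonneg x (show q ≠ 0 by omega)
  constructor
  · intro hm
    obtain ⟨-, h1 | ⟨-, h1⟩⟩ := isReachable_of_mem_mixedSum (by omega) hm
    · rintro ⟨h2, -⟩; omega
    · rintro ⟨-, h2, h3, h4⟩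
      rcases h1 h2 with h5 | ⟨h5, h6⟩
      · exact h3 h5
      · rcases h4 with h4 | h4
        · omega
        · exact h6 h4
  · intro hn
    by_cases h1 : 2 * h ≤ x
    · exact mem_mixedSum_residueBlock_of_large hh ha hb h1 hxk
    by_cases h2 : x % q = 0
    · have h3 : x = 0 ∨ (h ≤ x ∧ x ∉ C) := by
        by_contra hc
        apply hn
        refine ⟨by omega, h2, by tauto, ?_⟩
        by_contra hc'
        push Not at hc'
        exact hc (Or.inr hc')
      have ha0 := zero_mem_residueBlock (q := q) (h := h) (C := C) (a := a) (by omega)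
      have hb0 := zero_mem_residueBlock (q := q) (h := h) (C := C) (a := b) (by omega)
      by_cases hs : s = 0
      · exact mem_mixedSum.2 ⟨0, zero_mem_kFold ha0, x, mem_kFold_of_mem hb0
          (mem_residueBlock.2 ⟨⟨hx, by omega⟩, Or.inr (Or.inr ⟨h2, h3⟩)⟩) (by omega), by simp⟩
      · exact mem_mixedSum.2 ⟨x, mem_kFold_of_mem ha0
          (mem_residueBlock.2 ⟨⟨hx, by omega⟩, Or.inr (Or.inr ⟨h2, h3⟩)⟩) (by omega), 0,
          zero_mem_kFold hb0, by simp⟩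
    · exact mem_mixedSum_residueBlock_of_residue (by omega) hx (by omega) (by omega) (by omega)
        (by omega)

/-- The number of elements of `[0, N]` missing from the sumset of reflected residue blocks. -/
theorem card_missing_reflect_residueBlock {q h : ℤ} {C : Finset ℤ} {a b N : ℤ} {s d : ℕ}
    (hk : 1 ≤ s + d) (hq : q = s + d + 1) (hh : 0 < h) (ha : 4 * h ≤ a) (hb : 4 * h ≤ b)
    (hC : ∀ c ∈ C, c % q = 0 ∧ h ≤ c ∧ c < 2 * h) (hN : N + h ≤ s * a + d * b) :
    (missing N s d (reflect a (residueBlock q h C a)) (reflect b (residueBlock q h C b))).card =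
      (C.filter (fun c => s * a + d * b - N ≤ c)).card := by
  rw [← Finset.card_image_of_injective (C.filter _)
    (sub_right_injective (b := (s * a + d * b : ℤ)))]
  congr 1
  ext x
  rw [mem_missing, Finset.mem_image]
  constructor
  · rintro ⟨⟨h0, h1⟩, h2⟩
    rw [mem_mixedSum_reflect, mem_mixedSum_residueBlock_iff hk hq hh.le ha hb (by omega) (by omega),
      not_not] at h2
    refine ⟨s * a + d * b - x, Finset.mem_filter.2 ⟨?_, by omega⟩, by simp⟩
    rcases h2.2.2.2 with h3 | h3
    · omega
    · exact h3
  · rintro ⟨c, hc, rfl⟩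
    rw [Finset.mem_filter] at hc
    obtain ⟨c1, c2, c3⟩ := hC c hc.1
    have hnn : 2 * h ≤ s * a + d * b := by
      by_cases hs : s = 0
      · have : b ≤ d * b := le_mul_of_one_le_left (by omega) (by omega)
        have : 0 ≤ s * a := mul_nonneg (by omega) (by omega)
        omega
      · have : a ≤ s * a := le_mul_of_one_le_left (by omega) (by omega)
        have : 0 ≤ d * b := mul_nonneg (by omega) (by omega)
        omega
    refine ⟨⟨by omega, by omega⟩, ?_⟩
    rw [mem_mixedSum_reflect, mem_mixedSum_residueBlock_iff hk hq hh.le ha hb (by omega) (by omega),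
      not_not, sub_sub_cancel]
    exact ⟨c3, c1, by omega, Or.inr hc.1⟩

theorem exists_finset_card_filter_le {T u v w : ℤ} {x y z : ℕ} (hx : x ≤ u) (hy : u + y ≤ v)
    (hz : v + z ≤ w) :
    ∃ C : Finset ℤ, (∀ c ∈ C, T ≤ c ∧ c < T + w) ∧
      (C.filter (fun c => T ≤ c)).card = x + (y + z) ∧
      (C.filter (fun c => T + u ≤ c)).card = y + z ∧
      (C.filter (fun c => T + v ≤ c)).card = z ∧
      (C.filter (fun c => T + w ≤ c)).card = 0 := by
  have hI : ∀ (l : ℤ) (m : ℕ), (Finset.Ico l (l + m)).card = m := by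
    intro l m
    rw [Int.card_Ico]
    omega
  have hyz : (Finset.Ico (T + u) (T + u + y) ∪ Finset.Ico (T + v) (T + v + z)).card = y + z := by
    rw [Finset.card_union_of_disjoint, hI, hI]
    rw [Finset.disjoint_left]
    intro c hc hc'
    rw [Finset.mem_Ico] at hc hc'
    omega
  refine ⟨Finset.Ico T (T + x) ∪
    (Finset.Ico (T + u) (T + u + y) ∪ Finset.Ico (T + v) (T + v + z)), ?_, ?_, ?_, ?_, ?_⟩
  · intro c hc
    simp only [Finset.mem_union, Finset.mem_Ico] at hc
    omega
  · rw [Finset.filter_true_of_mem, Finset.card_union_of_disjoint, hyz, hI]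
    · rw [Finset.disjoint_left]
      intro c hc hc'
      simp only [Finset.mem_union, Finset.mem_Ico] at hc hc'
      omega
    · intro c hc
      simp only [Finset.mem_union, Finset.mem_Ico] at hc
      omega
  · rw [← hyz]
    congr 1
    ext c
    simp only [Finset.mem_filter, Finset.mem_union, Finset.mem_Ico]
    omega
  · conv_rhs => rw [← hI (T + v) z]
    congr 1
    ext c
    simp only [Finset.mem_filter, Finset.mem_union, Finset.mem_Ico]
    omega
  · rw [Finset.card_eq_zero, Finset.filter_eq_empty_iff]
    intro c hc
    simp only [Finset.mem_union, Finset.mem_Ico] at hc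
    omega

/-- A pair of fringes with prescribed numbers of missing sums. -/
theorem exists_fringe {s₁ d₁ s₂ d₂ k : ℕ} (h₁ : s₁ + d₁ = k) (h₂ : s₂ + d₂ = k) (hk : 2 ≤ k)
    (hd : d₁ < d₂) (hds : d₂ ≤ s₂) {i j : ℕ} (hij : j ≤ 2 * i) (hev : s₂ = d₂ → Even j) :
    ∃ (N : ℤ) (L R : Finset ℤ), 0 ≤ N ∧ L ⊆ Finset.Icc 0 N ∧ R ⊆ Finset.Icc 0 N ∧
      0 ∈ L ∧ 0 ∈ R ∧
      (missing N s₁ d₁ L R).card + (missing N d₁ s₁ L R).card = i ∧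
      (missing N s₂ d₂ L R).card + (missing N d₂ s₂ L R).card = j := by
  obtain ⟨y, z, hyz, hy1, hy0⟩ : ∃ y z : ℕ, j = y + 2 * z ∧ y ≤ 1 ∧ (s₂ = d₂ → y = 0) := by
    refine ⟨j % 2, j / 2, by omega, by omega, fun h => ?_⟩
    exact Nat.even_iff.1 (hev h)
  obtain ⟨x, hx⟩ : ∃ x : ℕ, i = x + (y + z) := ⟨i - (y + z), by omega⟩
  set D : ℤ := i + 1 with hD
  set T : ℤ := (k + 1) * D with hT
  set q : ℤ := k + 1 with hq
  have hDpos : 0 < D := by omega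
  have hqpos : 0 < q := by omega
  have hTpos : 0 < T := by positivity
  have hmono : ∀ m l : ℤ, m + 1 ≤ l → m * D + D ≤ l * D := by
    intro m l hml
    have := mul_le_mul_of_nonneg_right hml hDpos.le
    linarith
  have e1 : D ≤ ((d₂ : ℤ) - d₁) * D := by have := hmono 0 (d₂ - d₁) (by omega); linarith
  have e2 : ((d₂ : ℤ) - d₁) * D + y ≤ ((s₂ : ℤ) - d₁) * D := by
    by_cases h : s₂ = d₂
    · simp [hy0 h, h]
    · have := hmono (d₂ - d₁) (s₂ - d₁) (by omega)
      omega
  have e3 := hmono (s₂ - d₁) (s₁ - d₁) (by omega)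
  have e4 := hmono (s₁ - d₁) (k + 1) (by omega)
  obtain ⟨C, hC, c1, c2, c3, c4⟩ := exists_finset_card_filter_le (T := T)
    (u := (d₂ - d₁) * D) (v := (s₂ - d₁) * D) (w := (s₁ - d₁) * D) (x := x) (y := y) (z := z)
    (by omega) e2 (by omega)
  set h : ℤ := q * T with hh
  have hhpos : 0 < h := by positivity
  set a : ℤ := 4 * h with ha
  set b : ℤ := a + q * D with hb
  have hqD : 0 < q * D := by positivity
  have hqDh : q * D ≤ h := mul_le_mul_of_nonneg_left (by omega) hqpos.le
  set N : ℤ := k * a + d₁ * (q * D) - h with hN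
  have hNb : b ≤ N := by
    have : 2 * a ≤ k * a := mul_le_mul_of_nonneg_right (by exact_mod_cast hk) (by omega)
    have : 0 ≤ d₁ * (q * D) := by positivity
    omega
  have hinj : Function.Injective (fun t : ℤ => q * t) := fun t t' htt => by
    exact mul_left_cancel₀ hqpos.ne' htt
  have hCq : ∀ c ∈ C.image (fun t => q * t), c % q = 0 ∧ h ≤ c ∧ c < 2 * h := by
    intro c hc
    obtain ⟨t, ht, rfl⟩ := Finset.mem_image.1 hc
    obtain ⟨t1, t2⟩ := hC t ht
    refine ⟨by simp, mul_le_mul_of_nonneg_left t1 hqpos.le, ?_⟩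
    have := mul_lt_mul_of_pos_left (show t < 2 * T by omega) hqpos
    linarith
  have key : ∀ s d : ℕ, s + d = k → d₁ ≤ d →
      (missing N s d (reflect a (residueBlock q h (C.image (fun t => q * t)) a))
        (reflect b (residueBlock q h (C.image (fun t => q * t)) b))).card =
      (C.filter (fun c => T + (d - d₁) * D ≤ c)).card := by
    intro s d hsd hdd
    have hs : (s : ℤ) = k - d := by omega
    have htop : (s * a + d * b : ℤ) - N = q * (T + (d - d₁) * D) := by
      rw [hs, hN, hb, hh]; ring
    have hge : T ≤ T + ((d : ℤ) - d₁) * D := by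
      have : 0 ≤ ((d : ℤ) - d₁) * D := mul_nonneg (by omega) hDpos.le
      omega
    rw [card_missing_reflect_residueBlock (by omega) (by omega) hhpos (by omega) (by omega) hCq,
      Finset.filter_image, Finset.card_image_of_injective _ hinj]
    · congr 1
      apply Finset.filter_congr
      intro c _
      rw [htop]
      exact mul_le_mul_iff_right₀ hqpos
    · have := mul_le_mul_of_nonneg_left hge hqpos.le
      omega
  refine ⟨N, reflect a (residueBlock q h (C.image (fun t => q * t)) a),
    reflect b (residueBlock q h (C.image (fun t => q * t)) b), by omega, ?_, ?_, ?_, ?_, ?_, ?_⟩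
  · intro t ht
    have := (mem_residueBlock.1 (mem_reflect.1 ht)).1
    rw [Finset.mem_Icc]
    omega
  · intro t ht
    have := (mem_residueBlock.1 (mem_reflect.1 ht)).1
    rw [Finset.mem_Icc]
    omega
  · rw [mem_reflect, mem_residueBlock]
    omega
  · rw [mem_reflect, mem_residueBlock]
    omega
  · rw [key s₁ d₁ h₁ le_rfl, key d₁ s₁ (by omega) (by omega), c4, sub_self, zero_mul, add_zero,
      add_zero, c1]
    omega
  · rw [key s₂ d₂ h₂ hd.le, key d₂ s₂ (by omega) (by omega), c2, c3]
    omega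

/-- Few sets `S ⊆ U` avoid many translates `{y, φ y}` of pairs, after adding a fixed set `F`. -/
theorem card_filter_avoid_pairs_le (F : Finset ℤ) (φ : ℤ → ℤ) (hφ : Function.Injective φ) :
    ∀ (m : ℕ) (t U : Finset ℤ), t.card = m →
      (∀ y ∈ t, y ∈ U ∪ F ∧ φ y ∈ U ∪ F) →
      ((U.powerset.filter (fun S => ∀ y ∈ t, ¬ (y ∈ S ∪ F ∧ φ y ∈ S ∪ F))).card : ℝ) ≤
        (10 / 11 : ℝ) ^ m * 2 ^ U.card := by
  intro m
  induction m using Nat.strong_induction_on with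
  | _ m ih =>
  intro t U htm htU
  rcases t.eq_empty_or_nonempty with rfl | ⟨y, hy⟩
  · obtain rfl : m = 0 := by simpa using htm.symm
    simp
  set e : Finset ℤ := {y, φ y} \ F with he
  have heU : e ⊆ U := by
    intro x hx
    rw [he, Finset.mem_sdiff, Finset.mem_insert, Finset.mem_singleton] at hx
    obtain ⟨rfl | rfl, hxF⟩ := hx
    · exact (Finset.mem_union.1 (htU _ hy).1).resolve_right hxF
    · exact (Finset.mem_union.1 (htU _ hy).2).resolve_right hxF
  have hecard : e.card ≤ 2 := (Finset.card_le_card Finset.sdiff_subset).trans Finset.card_le_two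
  obtain ⟨t', ht'⟩ : ∃ t', t' = t.filter (fun x => x ∉ e ∧ φ x ∉ e) := ⟨_, rfl⟩
  have ht'card : t.card ≤ t'.card + 3 := by
    have hsub : t \ t' ⊆ {y, φ y} ∪ (t \ t').filter (fun x => φ x = y) := by
      intro x hx
      have hx' := hx
      simp only [ht', Finset.mem_sdiff, Finset.mem_filter, not_and, not_not] at hx'
      simp only [Finset.mem_union, Finset.mem_insert, Finset.mem_singleton, Finset.mem_filter]
      by_cases hxe : x ∈ e
      · rw [he, Finset.mem_sdiff, Finset.mem_insert, Finset.mem_singleton] at hxe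
        exact Or.inl hxe.1
      · have h1 := hx'.2 hx'.1 hxe
        rw [he, Finset.mem_sdiff, Finset.mem_insert, Finset.mem_singleton] at h1
        rcases h1.1 with h2 | h2
        · exact Or.inr ⟨hx, h2⟩
        · exact Or.inl (Or.inl (hφ h2))
    have h1 : ((t \ t').filter (fun x => φ x = y)).card ≤ 1 := by
      rw [Finset.card_le_one]
      intro u hu v hv
      exact hφ ((Finset.mem_filter.1 hu).2.trans (Finset.mem_filter.1 hv).2.symm)
    have h2 := Finset.card_le_card hsub
    have h3 := Finset.card_union_le ({y, φ y} : Finset ℤ) ((t \ t').filter (fun x => φ x = y))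
    have h4 : ({y, φ y} : Finset ℤ).card ≤ 2 := Finset.card_le_two
    have h5 := Finset.card_sdiff_add_card_eq_card (show t' ⊆ t by rw [ht']; exact Finset.filter_subset _ _)
    omega
  rcases e.eq_empty_or_nonempty with hee | hne
  · rw [Finset.filter_false_of_mem, Finset.card_empty, Nat.cast_zero]
    · positivity
    · intro S _ hS
      rw [he, Finset.sdiff_eq_empty_iff_subset] at hee
      exact hS y hy ⟨Finset.mem_union_right _ (hee (by simp)),
        Finset.mem_union_right _ (hee (by simp))⟩
  have hyt' : y ∉ t' := by
    intro h
    rw [ht', Finset.mem_filter] at h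
    obtain ⟨x, hx⟩ := hne
    have hx' := hx
    rw [he, Finset.mem_sdiff, Finset.mem_insert, Finset.mem_singleton] at hx'
    rcases hx'.1 with rfl | rfl
    · exact h.2.1 hx
    · exact h.2.2 hx
  have hsub' : t' ⊆ t := by rw [ht']; exact Finset.filter_subset _ _
  have hlt : t'.card < m := by
    rw [← htm]
    exact Finset.card_lt_card ((Finset.ssubset_iff_of_subset hsub').2 ⟨y, hy, hyt'⟩)
  have hIH := ih t'.card hlt t' (U \ e) rfl (by
    intro x hx
    rw [ht', Finset.mem_filter] at hx
    have := htU x hx.1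
    simp only [Finset.mem_union, Finset.mem_sdiff] at this ⊢
    tauto)
  have hcount : (U.powerset.filter (fun S => ∀ y ∈ t, ¬ (y ∈ S ∪ F ∧ φ y ∈ S ∪ F))).card ≤
      (2 ^ e.card - 1) * ((U \ e).powerset.filter
        (fun S => ∀ y ∈ t', ¬ (y ∈ S ∪ F ∧ φ y ∈ S ∪ F))).card := by
    rw [← Finset.card_powerset e, ← Finset.card_erase_of_mem (Finset.mem_powerset_self e),
      ← Finset.card_product]
    apply Finset.card_le_card_of_injOn (fun S => (S ∩ e, S \ e))
    · intro S hS
      simp only [Finset.coe_filter, Set.mem_ofPred_eq, Finset.mem_powerset] at hS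
      obtain ⟨hSU, hS⟩ := hS
      simp only [Finset.coe_product, Set.mem_prod, Finset.mem_coe, Finset.mem_erase,
        Finset.mem_powerset, Finset.mem_filter]
      refine ⟨⟨fun h => ?_, Finset.inter_subset_right⟩, Finset.sdiff_subset_sdiff hSU le_rfl, ?_⟩
      · apply hS y hy
        rw [Finset.inter_eq_right] at h
        constructor
        · by_cases hF : y ∈ F
          · exact Finset.mem_union_right _ hF
          · exact Finset.mem_union_left _ (h (by simp [he, hF]))
        · by_cases hF : φ y ∈ F
          · exact Finset.mem_union_right _ hF
          · exact Finset.mem_union_left _ (h (by simp [he, hF]))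
      · intro x hx hc
        exact hS x (hsub' hx) ⟨Finset.union_subset_union_left Finset.sdiff_subset hc.1,
          Finset.union_subset_union_left Finset.sdiff_subset hc.2⟩
    · intro S _ S' _ h
      simp only [Prod.mk.injEq] at h
      rw [← Finset.sdiff_union_inter S e, h.1, h.2, Finset.sdiff_union_inter]
  have hU : (2 : ℝ) ^ U.card = 2 ^ e.card * 2 ^ (U \ e).card := by
    rw [← pow_add, ← Finset.card_sdiff_add_card_eq_card heU, add_comm]
  have hfrac : ((2 ^ e.card - 1 : ℕ) : ℝ) ≤ 3 / 4 * 2 ^ e.card := by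
    interval_cases e.card <;> norm_num
  have hpow : (10 / 11 : ℝ) ^ t'.card * (3 / 4) ≤ (10 / 11 : ℝ) ^ m := by
    calc (10 / 11 : ℝ) ^ t'.card * (3 / 4) ≤ (10 / 11 : ℝ) ^ t'.card * (10 / 11) ^ 3 := by
          gcongr; norm_num
      _ = (10 / 11 : ℝ) ^ (t'.card + 3) := by rw [pow_add]
      _ ≤ (10 / 11 : ℝ) ^ m :=
          pow_le_pow_of_le_one (by norm_num) (by norm_num) (by omega)
  calc _ ≤ ((2 ^ e.card - 1 : ℕ) : ℝ) * (((U \ e).powerset.filter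
        (fun S => ∀ y ∈ t', ¬ (y ∈ S ∪ F ∧ φ y ∈ S ∪ F))).card : ℝ) := by exact_mod_cast hcount
    _ ≤ (3 / 4 * 2 ^ e.card) * ((10 / 11 : ℝ) ^ t'.card * 2 ^ (U \ e).card) := by gcongr
    _ = ((10 / 11 : ℝ) ^ t'.card * (3 / 4)) * 2 ^ U.card := by rw [hU]; ring
    _ ≤ _ := by gcongr

theorem sum_pow_le_of_injOn {ι : Type*} (s : Finset ι) (e : ι → ℕ) (e₀ : ℕ)
    (he : Set.InjOn e s) (hle : ∀ i ∈ s, e₀ ≤ e i) :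
    ∑ i ∈ s, (10 / 11 : ℝ) ^ e i ≤ 11 * (10 / 11 : ℝ) ^ e₀ := by
  have hinj : Set.InjOn (fun i => e i - e₀) s := by
    intro i hi j hj h
    have h1 := hle i hi
    have h2 := hle j hj
    apply he hi hj
    simp only at h
    omega
  have h1 : ∑ i ∈ s, (10 / 11 : ℝ) ^ e i =
      (10 / 11 : ℝ) ^ e₀ * ∑ l ∈ s.image (fun i => e i - e₀), (10 / 11 : ℝ) ^ l := by
    rw [Finset.sum_image hinj, Finset.mul_sum]
    refine Finset.sum_congr rfl fun i hi => ?_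
    rw [← pow_add, Nat.add_sub_cancel' (hle i hi)]
  have h2 : ∑ l ∈ s.image (fun i => e i - e₀), (10 / 11 : ℝ) ^ l ≤ 11 := by
    calc _ ≤ ∑' l : ℕ, (10 / 11 : ℝ) ^ l :=
          (summable_geometric_of_lt_one (by norm_num) (by norm_num)).sum_le_tsum _
            (fun _ _ => by positivity)
      _ = 11 := by
          rw [tsum_geometric_of_lt_one (by norm_num) (by norm_num)]
          norm_num
  rw [h1, mul_comm]
  gcongr

/-- Most sets `S ⊆ [W, n - W]`, completed by full blocks near both ends, satisfy `x + g y = m` for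
all `m` in the bulk of `[0, 2n]`. -/
theorem exists_width_half_le_card (N : ℤ) (hN : 0 ≤ N) :
    ∃ W : ℤ, 2 * N + 2 ≤ W ∧ ∀ n : ℤ, 2 * W ≤ n → ∀ g : ℤ → ℤ,
      (g = (fun x => x) ∨ g = fun x => n - x) →
      (2 : ℝ) ^ (Finset.Icc W (n - W)).card / 2 ≤
        (((Finset.Icc W (n - W)).powerset.filter (fun S =>
          ∀ m ∈ Finset.Icc (2 * W - 1) (2 * n - 2 * W + 1), ∃ x,
            x ∈ S ∪ (Finset.Icc (N + 1) (W - 1) ∪ Finset.Icc (n - W + 1) (n - N - 1)) ∧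
            g (m - x) ∈ S ∪ (Finset.Icc (N + 1) (W - 1) ∪
              Finset.Icc (n - W + 1) (n - N - 1)))).card : ℝ) := by
  obtain ⟨e₀, he₀⟩ := exists_pow_lt_of_lt_one (show (0 : ℝ) < 1 / 44 by norm_num)
    (show (10 / 11 : ℝ) < 1 by norm_num)
  refine ⟨2 * N + 2 + e₀, by omega, fun n hn g hg => ?_⟩
  set W : ℤ := 2 * N + 2 + e₀ with hW
  set U := Finset.Icc W (n - W) with hU
  set F := Finset.Icc (N + 1) (W - 1) ∪ Finset.Icc (n - W + 1) (n - N - 1) with hF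
  set M := Finset.Icc (2 * W - 1) (2 * n - 2 * W + 1) with hM
  set bad : ℤ → Finset (Finset ℤ) := fun m => U.powerset.filter
    (fun S => ∀ y ∈ Finset.Icc (max (N + 1) (m - n + N + 1)) (min (n - N - 1) (m - N - 1)),
      ¬ (y ∈ S ∪ F ∧ g (m - y) ∈ S ∪ F)) with hbad
  have hUF : ∀ x, N + 1 ≤ x → x ≤ n - N - 1 → x ∈ U ∪ F := by
    intro x h1 h2
    simp only [hU, hF, Finset.mem_union, Finset.mem_Icc]
    omega
  have hginj : Function.Injective g := by
    rcases hg with rfl | rfl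
    · exact fun _ _ h => h
    · exact sub_right_injective
  have hgrange : ∀ x, N + 1 ≤ x → x ≤ n - N - 1 → N + 1 ≤ g x ∧ g x ≤ n - N - 1 := by
    intro x h1 h2
    rcases hg with rfl | rfl
    · exact ⟨h1, h2⟩
    · constructor <;> dsimp only <;> omega
  have hbadcard : ∀ m : ℤ, ((bad m).card : ℝ) ≤
      (10 / 11 : ℝ) ^ (min (m - 2 * N - 1) (2 * n - m - 2 * N - 1)).toNat * 2 ^ U.card := by
    intro m
    refine card_filter_avoid_pairs_le F (fun y => g (m - y))
      (hginj.comp sub_right_injective) _ _ U ?_ ?_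
    · rw [Int.card_Icc]
      omega
    · intro y hy
      rw [Finset.mem_Icc] at hy
      have := hgrange (m - y) (by omega) (by omega)
      exact ⟨hUF y (by omega) (by omega), hUF _ this.1 this.2⟩
  have hsum : ∑ m ∈ M, (10 / 11 : ℝ) ^ (min (m - 2 * N - 1) (2 * n - m - 2 * N - 1)).toNat ≤
      1 / 2 := by
    rw [← Finset.sum_filter_add_sum_filter_not M (fun m => m ≤ n)]
    have h1 : ∑ m ∈ M.filter (fun m => m ≤ n),
        (10 / 11 : ℝ) ^ (min (m - 2 * N - 1) (2 * n - m - 2 * N - 1)).toNat ≤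
        11 * (10 / 11 : ℝ) ^ e₀ := by
      apply sum_pow_le_of_injOn
      · intro x hx y hy h
        simp only [hM, Finset.coe_filter, Set.mem_ofPred_eq, Finset.mem_Icc] at hx hy
        simp only at h
        omega
      · intro x hx
        simp only [hM, Finset.mem_filter, Finset.mem_Icc] at hx
        omega
    have h2 : ∑ m ∈ M.filter (fun m => ¬ m ≤ n),
        (10 / 11 : ℝ) ^ (min (m - 2 * N - 1) (2 * n - m - 2 * N - 1)).toNat ≤
        11 * (10 / 11 : ℝ) ^ e₀ := by
      apply sum_pow_le_of_injOn
      · intro x hx y hy h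
        simp only [hM, Finset.coe_filter, Set.mem_ofPred_eq, Finset.mem_Icc] at hx hy
        simp only at h
        omega
      · intro x hx
        simp only [hM, Finset.mem_filter, Finset.mem_Icc] at hx
        omega
    linarith
  have hcover : U.powerset ⊆ U.powerset.filter (fun S => ∀ m ∈ M, ∃ x, x ∈ S ∪ F ∧
      g (m - x) ∈ S ∪ F) ∪ M.biUnion bad := by
    intro S hS
    rw [Finset.mem_union, Finset.mem_filter, Finset.mem_biUnion]
    by_contra hc
    push Not at hc
    obtain ⟨m, hm, hm'⟩ := hc.1 hS
    exact hc.2 m hm (Finset.mem_filter.2 ⟨hS, fun y _ hy => hm' y hy.1 hy.2⟩)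
  have h1 := (Finset.card_le_card hcover).trans ((Finset.card_union_le _ _).trans
    (Nat.add_le_add_left Finset.card_biUnion_le _))
  rw [Finset.card_powerset] at h1
  have h2 : ((2 ^ U.card : ℕ) : ℝ) ≤ _ := Nat.cast_le.2 h1
  push_cast at h2
  have h3 : ∑ m ∈ M, ((bad m).card : ℝ) ≤ 1 / 2 * 2 ^ U.card :=
    (Finset.sum_le_sum fun m _ => hbadcard m).trans (by
      rw [← Finset.sum_mul]
      gcongr)
  linarith

/-- The set with fringe `L` near `0`, fringe `n - R` near `n`, and middle part `S`. -/
def glue (n : ℤ) (L R S : Finset ℤ) : Finset ℤ :=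
  L ∪ S ∪ reflect n R

theorem mem_glue {n : ℤ} {L R S : Finset ℤ} {x : ℤ} :
    x ∈ glue n L R S ↔ x ∈ L ∨ x ∈ S ∨ n - x ∈ R := by
  rw [glue, Finset.mem_union, Finset.mem_union, mem_reflect, or_assoc]

theorem hasFringe_glue {n N : ℤ} {L R S : Finset ℤ} (hL : L ⊆ Finset.Icc 0 N)
    (hR : R ⊆ Finset.Icc 0 N) (hS : S ⊆ Finset.Icc (N + 1) (n - N - 1)) (hN : 0 ≤ N)
    (hn : 2 * N < n) : HasFringe n N L R (glue n L R S) := by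
  have hL' : ∀ y ∈ L, 0 ≤ y ∧ y ≤ N := fun y hy => Finset.mem_Icc.1 (hL hy)
  have hR' : ∀ y ∈ R, 0 ≤ y ∧ y ≤ N := fun y hy => Finset.mem_Icc.1 (hR hy)
  have hS' : ∀ y ∈ S, N + 1 ≤ y ∧ y ≤ n - N - 1 := fun y hy => Finset.mem_Icc.1 (hS hy)
  refine ⟨fun x hx => ?_, fun x hx => ?_, fun x hx => ?_⟩
  · rw [Finset.mem_Icc]
    rcases mem_glue.1 hx with h | h | h
    · have := hL' x h; omega
    · have := hS' x h; omega
    · have := hR' _ h; omega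
  · rw [mem_glue]
    constructor
    · rintro (h | h | h)
      · exact h
      · have := hS' x h; omega
      · have := hR' _ h; omega
    · exact Or.inl
  · rw [mem_glue, sub_sub_cancel]
    constructor
    · rintro (h | h | h)
      · have := hL' _ h; omega
      · have := hS' _ h; omega
      · exact h
    · exact fun h => Or.inr (Or.inr h)

theorem Icc_subset_add_of_blocks {n N W : ℤ} {A G : Finset ℤ} (hW : 2 * N + 2 ≤ W) (hN : 0 ≤ N)
    (hA0 : 0 ∈ A) (hAn : n ∈ A)
    (hA : ∀ x, N + 1 ≤ x → x ≤ W - 1 → x ∈ A ∧ n - x ∈ A)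
    (hG : ∀ x, N + 1 ≤ x → x ≤ W - 1 → x ∈ G ∧ n - x ∈ G)
    (hmid : ∀ m ∈ Finset.Icc (2 * W - 1) (2 * n - 2 * W + 1), m ∈ A + G) :
    Finset.Icc (N + 1) (2 * n - N - 1) ⊆ A + G := by
  intro m hm
  rw [Finset.mem_Icc] at hm
  by_cases h1 : m ≤ W - 1
  · exact Finset.mem_add.2 ⟨0, hA0, m, (hG m hm.1 h1).1, by simp⟩
  by_cases h2 : m ≤ 2 * W - 2
  · exact Finset.mem_add.2 ⟨max (N + 1) (m - (W - 1)), (hA _ (by omega) (by omega)).1,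
      m - max (N + 1) (m - (W - 1)), (hG _ (by omega) (by omega)).1, by ring⟩
  by_cases h3 : 2 * n - m ≤ W - 1
  · have := (hG (2 * n - m) (by omega) h3).2
    exact Finset.mem_add.2 ⟨n, hAn, _, this, by ring⟩
  by_cases h4 : 2 * n - m ≤ 2 * W - 2
  · exact Finset.mem_add.2 ⟨_, (hA (max (N + 1) (2 * n - m - (W - 1))) (by omega) (by omega)).2,
      _, (hG (2 * n - m - max (N + 1) (2 * n - m - (W - 1))) (by omega) (by omega)).2, by ring⟩
  · exact hmid m (Finset.mem_Icc.2 ⟨by omega, by omega⟩)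

theorem eventually_exists_card_sumDiff {k : ℕ} (hk : 2 ≤ k) {N : ℤ} {L R : Finset ℤ} (hN : 0 ≤ N)
    (hL : L ⊆ Finset.Icc 0 N) (hR : R ⊆ Finset.Icc 0 N) (hL0 : 0 ∈ L) (hR0 : 0 ∈ R) :
    ∀ᶠ n : ℕ in Filter.atTop, ∃ A : Finset ℤ, A ⊆ Finset.Icc (0 : ℤ) (n : ℤ) ∧
      ∀ s d : ℕ, d ≤ s → s + d = k → ((sumDiff s d A).card : ℤ) =
        k * n + 1 - ((missing N s d L R).card + (missing N d s L R).card : ℕ) := by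
  filter_upwards [Filter.eventually_ge_atTop (4 * N + 4).toNat] with n hn
  have hn' : 4 * N + 4 ≤ n := by omega
  have hF := hasFringe_glue (n := n) hL hR (subset_refl (Finset.Icc (N + 1) (n - N - 1))) hN
    (by omega)
  refine ⟨_, hF.subset, fun s d hds hsd => ?_⟩
  have hskn : ((s : ℤ) + d) = k := by omega
  have h2n : 2 * (n : ℤ) ≤ k * n := mul_le_mul_of_nonneg_right (by exact_mod_cast hk) (by omega)
  rw [hF.card_sumDiff_eq hL hR hN (by rw [hskn]; omega), hskn]
  · push_cast; ring
  · have h0 : (0 : ℤ) ∈ glue n L R (Finset.Icc (N + 1) (n - N - 1)) := mem_glue.2 (Or.inl hL0)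
    have h1 : (n : ℤ) ∈ glue n L R (Finset.Icc (N + 1) (n - N - 1)) :=
      mem_glue.2 (Or.inr (Or.inr (by simpa using hR0)))
    have hblk : ∀ x, N + 1 ≤ x → x ≤ n - N - 1 →
        x ∈ glue n L R (Finset.Icc (N + 1) (n - N - 1)) := fun x hx hx' =>
      mem_glue.2 (Or.inr (Or.inl (Finset.mem_Icc.2 ⟨hx, hx'⟩)))
    refine Icc_subset_mixedSum hds (by omega) h0 h1 hN (by omega) ?_
    refine Icc_subset_add_of_blocks (W := n - N) (by omega) hN h0 h1
      (fun x hx hx' => ⟨hblk x hx (by omega), hblk _ (by omega) (by omega)⟩)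
      (fun x hx hx' => ?_) (fun m hm => ?_)
    · split_ifs
      · exact ⟨hblk x hx (by omega), hblk _ (by omega) (by omega)⟩
      · exact ⟨mem_reflect.2 (hblk _ (by omega) (by omega)),
          mem_reflect.2 (hblk _ (by omega) (by omega))⟩
    · rw [Finset.mem_Icc] at hm
      omega

theorem exists_proportion {s d s' d' k : ℕ} (hk : 2 ≤ k) (hsd : s + d = k) (hsd' : s' + d' = k)
    (hds : d ≤ s) {N : ℤ} {L R : Finset ℤ} (hN : 0 ≤ N)
    (hL : L ⊆ Finset.Icc 0 N) (hR : R ⊆ Finset.Icc 0 N) (hL0 : 0 ∈ L) (hR0 : 0 ∈ R)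
    (hlt : (missing N s d L R).card + (missing N d s L R).card <
      (missing N s' d' L R).card + (missing N d' s' L R).card) :
    ∃ c : ℝ, 0 < c ∧ ∀ᶠ n : ℕ in Filter.atTop,
      c * (2 : ℝ) ^ (n + 1) ≤
        (((Finset.Icc (0 : ℤ) (n : ℤ)).powerset.filter
          (fun A : Finset ℤ => (sumDiff s' d' A).card < (sumDiff s d A).card)).card : ℝ) := by
  obtain ⟨W, hW, hcount⟩ := exists_width_half_le_card N hN
  refine ⟨1 / 2 / 2 ^ (2 * W).toNat, by positivity, ?_⟩
  filter_upwards [Filter.eventually_ge_atTop (2 * W).toNat] with n hn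
  have hn' : 2 * W ≤ n := by omega
  have hskn : ((s : ℤ) + d) = k := by omega
  have hskn' : ((s' : ℤ) + d') = k := by omega
  have h2n : 2 * (n : ℤ) ≤ k * n := mul_le_mul_of_nonneg_right (by exact_mod_cast hk) (by omega)
  have hc := hcount n hn' (if 2 ≤ s then fun x => x else fun x => n - x) (by
    split_ifs
    · exact Or.inl rfl
    · exact Or.inr rfl)
  set U := Finset.Icc W (n - W) with hU
  set F := Finset.Icc (N + 1) (W - 1) ∪ Finset.Icc (n - W + 1) (n - N - 1) with hF
  have hpow : (1 / 2 / 2 ^ (2 * W).toNat * (2 : ℝ) ^ (n + 1)) = 2 ^ U.card / 2 := by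
    have : n + 1 = U.card + (2 * W).toNat := by
      rw [hU, Int.card_Icc]; omega
    rw [this, pow_add]
    field_simp
  rw [hpow]
  refine hc.trans ?_
  rw [Nat.cast_le]
  apply Finset.card_le_card_of_injOn (fun S => glue n L R (S ∪ F))
  · intro S hS
    simp only [Finset.coe_filter, Set.mem_ofPred_eq, Finset.mem_powerset] at hS ⊢
    obtain ⟨hSU, hS⟩ := hS
    have hmidsub : S ∪ F ⊆ Finset.Icc (N + 1) (n - N - 1) := by
      intro x hx
      rw [Finset.mem_Icc]
      rcases Finset.mem_union.1 hx with hx | hx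
      · have := Finset.mem_Icc.1 (hSU hx)
        omega
      · simp only [hF, Finset.mem_union, Finset.mem_Icc] at hx
        omega
    have hfr := hasFringe_glue (n := n) hL hR hmidsub hN (by omega)
    refine ⟨hfr.subset, ?_⟩
    have h0 : (0 : ℤ) ∈ glue n L R (S ∪ F) := mem_glue.2 (Or.inl hL0)
    have h1 : (n : ℤ) ∈ glue n L R (S ∪ F) := mem_glue.2 (Or.inr (Or.inr (by simpa using hR0)))
    have hblk : ∀ x, N + 1 ≤ x → x ≤ W - 1 →
        x ∈ glue n L R (S ∪ F) ∧ n - x ∈ glue n L R (S ∪ F) := by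
      intro x hx hx'
      refine ⟨mem_glue.2 (Or.inr (Or.inl (Finset.mem_union_right _ ?_))),
        mem_glue.2 (Or.inr (Or.inl (Finset.mem_union_right _ ?_)))⟩
      · exact Finset.mem_union_left _ (Finset.mem_Icc.2 ⟨hx, hx'⟩)
      · exact Finset.mem_union_right _ (Finset.mem_Icc.2 ⟨by omega, by omega⟩)
    have hle := hfr.card_sumDiff_le hL hR hN (s := s') (d := d') (by rw [hskn']; omega)
    have heq := hfr.card_sumDiff_eq hL hR hN (s := s) (d := d) (by rw [hskn]; omega) (by
      refine Icc_subset_mixedSum hds (by omega) h0 h1 hN (by omega) ?_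
      refine Icc_subset_add_of_blocks hW hN h0 h1 hblk (fun x hx hx' => ?_) (fun m hm => ?_)
      · split_ifs
        · exact hblk x hx hx'
        · rw [mem_reflect, mem_reflect, sub_sub_cancel]
          exact (hblk x hx hx').symm
      · obtain ⟨x, hx, hgx⟩ := hS m hm
        refine Finset.mem_add.2 ⟨x, mem_glue.2 (Or.inr (Or.inl hx)), m - x, ?_, by ring⟩
        split_ifs at hgx ⊢
        · exact mem_glue.2 (Or.inr (Or.inl hgx))
        · exact mem_reflect.2 (mem_glue.2 (Or.inr (Or.inl hgx))))
    rw [hskn'] at hle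
    rw [hskn] at heq
    omega
  · intro S hS S' hS' h
    simp only [Finset.coe_filter, Set.mem_ofPred_eq, Finset.mem_powerset] at hS hS'
    have key : ∀ T ⊆ U, glue n L R (T ∪ F) ∩ U = T := by
      intro T hT
      ext x
      rw [Finset.mem_inter, mem_glue, Finset.mem_union]
      constructor
      · rintro ⟨h1, h2⟩
        rw [hU, Finset.mem_Icc] at h2
        rcases h1 with h1 | (h1 | h1) | h1
        · have := Finset.mem_Icc.1 (hL h1)
          omega
        · exact h1
        · simp only [hF, Finset.mem_union, Finset.mem_Icc] at h1
          omega
        · have := Finset.mem_Icc.1 (hR h1)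
          omega
      · exact fun h => ⟨Or.inr (Or.inl (Or.inl h)), hT h⟩
    simp only at h
    rw [← key S hS.1, h, key S' hS'.1]

theorem exists_proportion_of_ne {s₁ d₁ s₂ d₂ k : ℕ} (h₁ : s₁ + d₁ = k) (h₂ : s₂ + d₂ = k)
    (hk : 2 ≤ k) (hds₁ : d₁ ≤ s₁) (hds₂ : d₂ ≤ s₂) (hne : s₁ ≠ s₂) :
    ∃ c : ℝ, 0 < c ∧ ∀ᶠ n : ℕ in Filter.atTop,
      c * (2 : ℝ) ^ (n + 1) ≤
        (((Finset.Icc (0 : ℤ) (n : ℤ)).powerset.filter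
          (fun A : Finset ℤ => (sumDiff s₂ d₂ A).card < (sumDiff s₁ d₁ A).card)).card : ℝ) := by
  rcases lt_or_gt_of_ne hne with hlt | hlt
  · obtain ⟨N, L, R, hN, hL, hR, hL0, hR0, hi, hj⟩ :=
      exists_fringe (i := 1) (j := 0) h₂ h₁ hk (by omega) hds₁ (by omega) (fun _ => by simp)
    exact exists_proportion hk h₁ h₂ hds₁ hN hL hR hL0 hR0 (by omega)
  · obtain ⟨N, L, R, hN, hL, hR, hL0, hR0, hi, hj⟩ :=
      exists_fringe (i := 1) (j := 2) h₁ h₂ hk (by omega) hds₂ (by omega) (fun _ => by simp)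
    exact exists_proportion hk h₁ h₂ hds₁ hN hL hR hL0 hR0 (by omega)

theorem exists_le_card_sumDiff_eq (s d : ℕ) :
    ∃ s' d' : ℕ, d' ≤ s' ∧ s' + d' = s + d ∧ (s' = s ∧ d' = d ∨ s' = d ∧ d' = s) ∧
      ∀ A : Finset ℤ, (sumDiff s d A).card = (sumDiff s' d' A).card := by
  rcases le_total d s with h | h
  · exact ⟨s, d, h, rfl, Or.inl ⟨rfl, rfl⟩, fun _ => rfl⟩
  · exact ⟨d, s, h, by omega, Or.inr ⟨rfl, rfl⟩, card_sumDiff_comm s d⟩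

theorem mainTheorem1 (s₁ d₁ s₂ d₂ k : ℕ) (h₁ : s₁ + d₁ = k) (h₂ : s₂ + d₂ = k) (hk : 2 ≤ k)
    (hne : ({s₁, d₁} : Set ℕ) ≠ {s₂, d₂}) :
    (∃ c : ℝ, 0 < c ∧ ∀ᶠ n : ℕ in Filter.atTop,
      c * (2 : ℝ) ^ (n + 1) ≤
        (((Finset.Icc (0 : ℤ) (n : ℤ)).powerset.filter
          (fun A : Finset ℤ => (sumDiff s₂ d₂ A).card < (sumDiff s₁ d₁ A).card)).card : ℝ)) ∧
    (d₁ ≤ s₁ → s₂ ≤ s₁ → d₂ ≤ s₁ →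
      ∀ i j : ℕ, j ≤ 2 * i → (s₂ = d₂ → Even j) →
        ∀ᶠ n : ℕ in Filter.atTop, ∃ A : Finset ℤ, A ⊆ Finset.Icc (0 : ℤ) (n : ℤ) ∧
          ((sumDiff s₁ d₁ A).card : ℤ) = (k : ℤ) * (n : ℤ) + 1 - (i : ℤ) ∧
          ((sumDiff s₂ d₂ A).card : ℤ) = (k : ℤ) * (n : ℤ) + 1 - (j : ℤ)) := by
  have hne' : s₁ ≠ s₂ ∧ s₁ ≠ d₂ := by
    constructor
    · rintro rfl
      obtain rfl : d₁ = d₂ := by omega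
      exact hne rfl
    · rintro rfl
      obtain rfl : d₁ = s₂ := by omega
      exact hne (Set.pair_comm _ _)
  obtain ⟨s, d, hds, hsd, hor, hcard⟩ := exists_le_card_sumDiff_eq s₂ d₂
  constructor
  · obtain ⟨s', d', hds', hsd', hor', hcard'⟩ := exists_le_card_sumDiff_eq s₁ d₁
    simp only [hcard, hcard']
    exact exists_proportion_of_ne (hsd'.trans h₁) (hsd.trans h₂) hk hds' hds (by omega)
  · intro hd hs hs' i j hij hev
    obtain ⟨N, L, R, hN, hL, hR, hL0, hR0, hi, hj⟩ :=
      exists_fringe h₁ (hsd.trans h₂) hk (by omega) hds hij (fun h => hev (by omega))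
    filter_upwards [eventually_exists_card_sumDiff hk hN hL hR hL0 hR0] with n ⟨A, hA, hcA⟩
    refine ⟨A, hA, ?_, ?_⟩
    · rw [hcA s₁ d₁ hd h₁, hi]
    · rw [hcard, hcA s d hds (hsd.trans h₂), hj]
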